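/- Let $\mathscr{X}$ be a finite non-empty set, $\mathscr{X}^*=\bigcup_{n\ge 0}\mathscr{X}^n$ the set of finite strings (situations), and $\Omega=\mathscr{X}^{\mathbb{N}}$ the set of paths. For $\omega\in\Omega$ let $\omega^n\in\mathscr{X}^n$ be the string of its first $n$ states; for $s\in\mathscr{X}^*$ of length $n$ let $\Gamma(s)=\{\omega\in\Omega:\omega^n=s\}$. For extended real variables $f,g:\Omega\to\overline{\mathbb{R}}$ write $g\ge_s f$ if $g(\omega)\ge f(\omega)$ for all $\omega\in\Gamma(s)$. An extended real function is bounded below if it is $\ge M$ everywhere for some real $M$. For every $s\in\mathscr{X}^*$ let a local upper expectation $\overline{\mathrm{Q}}_s$ be given, that is, a map from the set of all functions $\mathscr{X}\to\overline{\mathbb{R}}$ to $\overline{\mathbb{R}}$ such that, for all bounded below $f,g:\mathscr{X}\to\overline{\mathbb{R}}$, all real $c$ and all real $\lambda>0$: $\overline{\mathrm{Q}}_s(c)=c$; $\overline{\mathrm{Q}}_s(f+g)\le\overline{\mathrm{Q}}_s(f)+\overline{\mathrm{Q}}_s(g)$; $\overline{\mathrm{Q}}_s(\lambda f)=\lambda\overline{\mathrm{Q}}_s(f)$;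 $f\le g$ implies $\overline{\mathrm{Q}}_s(f)\le\overline{\mathrm{Q}}_s(g)$; and $\lim_n\overline{\mathrm{Q}}_s(f_n)=\overline{\mathrm{Q}}_s(\lim_n f_n)$ for every non-decreasing sequence $(f_n)$ of non-negative functions $\mathscr{X}\to\overline{\mathbb{R}}$. Such a family is called an imprecise probabilities tree. Let $\overline{\mathbb{M}}_{\mathrm b}$ be the set of all bounded below $\mathscr{M}:\mathscr{X}^*\to\overline{\mathbb{R}}$ with $\overline{\mathrm{Q}}_s(x\mapsto\mathscr{M}(sx))\le\mathscr{M}(s)$ for all $s\in\mathscr{X}^*$, and define, for $f:\Omega\to\overline{\mathbb{R}}$ and $s\in\mathscr{X}^*$, $$\overline{\mathrm{E}}_{\mathrm V}(f|s)=\inf\Big\{\mathscr{M}(s):\mathscr{M}\in\overline{\mathbb{M}}_{\mathrm b},\ \liminf_{n\to\infty}\mathscr{M}(\omega^n)\ge f(\omega)\text{ for all }\omega\in\Gamma(s)\Big\}.$$ Call $f:\Omega\to\overline{\mathbb{R}}$ finitary if for some $n\ge 0$ the value $f(\omega)$ depends only on $\omega^n$, and let $\overline{\mathbb{V}}_{b,\lim}$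 be the set of all bounded below $g:\Omega\to\overline{\mathbb{R}}$ that are pointwise limits of sequences of finitary variables. Then for all $f:\Omega\to\overline{\mathbb{R}}$ and $s\in\mathscr{X}^*$, $$\overline{\mathrm{E}}_{\mathrm V}(f|s)=\inf\{\overline{\mathrm{E}}_{\mathrm V}(g|s):g\in\overline{\mathbb{V}}_{b,\lim},\ g\ge_s f\}=\inf\{\overline{\mathrm{E}}_{\mathrm V}(g|s):g\in\overline{\mathbb{V}}_{b,\lim},\ g\ge f\}.$$ Consequently $\overline{\mathrm{E}}_{\mathrm V}$ is uniquely determined by its values on $\overline{\mathbb{V}}_{b,\lim}$: if, for some situation $s$, the upper expectations obtained from two imprecise probabilities trees on $\mathscr{X}$ agree on $\overline{\mathbb{V}}_{b,\lim}$ conditional on $s$, then they agree on all extended real variables on $\Omega$ conditional on $s$. -/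

import Mathlib

open Filter Topology

namespace GameTheoretic

/-- An extended real variable `f` on `Y` is bounded below if `f ≥ M` for some real `M`. -/
def BddBelowVar {Y : Type*} (f : Y → EReal) : Prop :=
  ∃ M : ℝ, ∀ y, (M : EReal) ≤ f y

/-- Upper expectations on the set of all extended real variables on `Y`. Sublinearity, positive
homogeneity, monotonicity and upward continuity are only imposed on variables that are bounded
below; for these, no sum `∞ - ∞` occurs, so the convention for such sums plays no role. -/
structure IsUpperExpectation {Y : Type*} (E : (Y → EReal) → EReal) : Prop where
  const : ∀ c : ℝ, E (fun _ => (c : EReal)) = c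
  add_le : ∀ f g : Y → EReal, BddBelowVar f → BddBelowVar g →
    E (fun y => f y + g y) ≤ E f + E g
  pos_homog : ∀ (r : ℝ) (f : Y → EReal), 0 < r → BddBelowVar f →
    E (fun y => (r : EReal) * f y) = (r : EReal) * E f
  mono : ∀ f g : Y → EReal, BddBelowVar f → BddBelowVar g → (∀ y, f y ≤ g y) → E f ≤ E g
  upward_cont : ∀ (f : ℕ → Y → EReal) (g : Y → EReal),
    (∀ n y, 0 ≤ f n y) → (∀ n y, f n y ≤ f (n + 1) y) →
    (∀ y, Tendsto (fun n => f n y) atTop (𝓝 (g y))) →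
    Tendsto (fun n => E (f n)) atTop (𝓝 (E g))

/-- Situations: finite strings `x₁ ⋯ xₙ` of states (`[]` is the initial situation). -/
abbrev Situation (X : Type*) := List X

/-- Paths: infinite sequences of states; `ω n` is the state at time `n + 1`. -/
abbrev Path (X : Type*) := ℕ → X

variable {X : Type*}

/-- The situation `ωⁿ` formed by the first `n` states of the path `ω`. -/
def Path.initial (ω : Path X) (n : ℕ) : Situation X :=
  List.ofFn (fun i : Fin n => ω i)

/-- The cylinder event `Γ(s)`: all paths that go through the situation `s`. -/
def cylinder (s : Situation X) : Set (Path X) :=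
  {ω | Path.initial ω s.length = s}

/-- An imprecise probabilities tree: a local upper expectation `Q s` on the extended real
variables on the state space, for every situation `s`. -/
def IsImpreciseTree (Q : Situation X → (X → EReal) → EReal) : Prop :=
  ∀ s, IsUpperExpectation (Q s)

/-- Extended real processes `M` with `Q s (M (s ·)) ≤ M s` for every situation `s`. -/
def IsSupermartingale (Q : Situation X → (X → EReal) → EReal) (M : Situation X → EReal) : Prop :=
  ∀ s, Q s (fun x => M (s ++ [x])) ≤ M s

/-- The global variable `liminf M`. -/
noncomputable def liminfProcess (M : Situation X → EReal) (ω : Path X) : EReal :=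
  liminf (fun n => M (Path.initial ω n)) atTop

/-- The global game-theoretic upper expectation of `f` conditional on `s`: the infimum of `M s`
over the bounded below supermartingales `M` with `liminf M ≥ f` on `Γ(s)`. -/
noncomputable def upperE (Q : Situation X → (X → EReal) → EReal)
    (f : Path X → EReal) (s : Situation X) : EReal :=
  sInf {a | ∃ M : Situation X → EReal, IsSupermartingale Q M ∧ BddBelowVar M ∧
    (∀ ω ∈ cylinder s, f ω ≤ liminfProcess M ω) ∧ a = M s}

/-- `f` is `n`-measurable: it is constant on the cylinder events of situations of length `n`. -/
def IsNMeasurable (n : ℕ) (f : Path X → EReal) : Prop :=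
  ∀ ω ω' : Path X, Path.initial ω n = Path.initial ω' n → f ω = f ω'

/-- Finitary (extended real) variables. -/
def IsFinitary (f : Path X → EReal) : Prop :=
  ∃ n : ℕ, IsNMeasurable n f

/-- The set of all bounded below global variables that are pointwise limits of sequences of
finitary variables. -/
def limFinitary (X : Type*) : Set (Path X → EReal) :=
  {g | BddBelowVar g ∧ ∃ u : ℕ → Path X → EReal, (∀ n, IsFinitary (u n)) ∧
    ∀ ω, Tendsto (fun n => u n ω) atTop (𝓝 (g ω))}

end GameTheoretic

/-!
Up to an arbitrarily small error, `upperE Q f s` is the value `M s` of a bounded below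
supermartingale `M` with `liminf M ≥ f` on `Γ(s)`, and making `M` infinite in the situations that
do not follow `s` extends this bound to all paths. Doob's upcrossing argument then replaces `M` by
a larger supermartingale `T` that converges on every path: buying one unit of `M` at or below `α`
and selling it at or above `β` earns `β - α` per upcrossing of `[α, β]`, so let `T` be `M` plus a
small weighted sum of such strategies over a countable dense set of levels. On a path where `M`
oscillates, one of them earns an infinite amount and `T` tends to `∞`; on a path where `M`
converges, every strategy eventually stops trading, and `T` converges as well, because the total
profit increases and the stakes are dominated by a summable sequence. The values of `T` at time `n`
depend on the first `n` states only, so `lim T` is a limit of finitary variables; it dominates `f`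
and its upper expectation conditional on `s` is at most `T s ≤ M s + ε`.
-/

open scoped ENNReal NNReal

namespace GameTheoretic

/-! ### Bounded below variables and supermartingales -/

section Supermartingale

variable {Y : Type*}

theorem bddBelowVar_coe_ennreal (f : Y → ℝ≥0∞) : BddBelowVar fun y => (f y : EReal) :=
  ⟨0, fun y => by simpa using EReal.coe_ennreal_nonneg (f y)⟩

theorem bddBelowVar_const (c : ℝ) : BddBelowVar fun _ : Y => (c : EReal) :=
  ⟨c, fun _ => le_rfl⟩

theorem BddBelowVar.comp {Z : Type*} {f : Y → EReal} (hf : BddBelowVar f) (φ : Z → Y) :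
    BddBelowVar fun z => f (φ z) :=
  let ⟨m, hm⟩ := hf
  ⟨m, fun z => hm (φ z)⟩

theorem BddBelowVar.add {f g : Y → EReal} (hf : BddBelowVar f) (hg : BddBelowVar g) :
    BddBelowVar fun y => f y + g y := by
  obtain ⟨⟨a, ha⟩, b, hb⟩ := hf, hg
  exact ⟨a + b, fun y => (EReal.coe_add a b).trans_le (add_le_add (ha y) (hb y))⟩

theorem BddBelowVar.exists_eq_coe_ennreal_add {f : Y → EReal} (hf : BddBelowVar f) :
    ∃ (c : ℝ) (g : Y → ℝ≥0∞), f = fun y => (g y : EReal) + c := by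
  obtain ⟨c, hc⟩ := hf
  refine ⟨c, fun y => (f y - c).toENNReal, funext fun y => ?_⟩
  have hnonneg : 0 ≤ f y - c :=
    (EReal.sub_nonneg (Or.inr (EReal.coe_ne_top c)) (Or.inr (EReal.coe_ne_bot c))).2 (hc y)
  rw [EReal.coe_toENNReal hnonneg, EReal.sub_add_cancel]

theorem IsUpperExpectation.const_le {E : (Y → EReal) → EReal} (hE : IsUpperExpectation E)
    (c : ℝ≥0∞) : E (fun _ => (c : EReal)) ≤ c := by
  induction c with
  | top => exact le_top
  | coe c => exact (hE.const c).le

variable {X : Type*} {Q : Situation X → (X → EReal) → EReal} {M M' : Situation X → EReal}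

theorem isSupermartingale_const (hQ : IsImpreciseTree Q) (c : ℝ) :
    IsSupermartingale Q fun _ => (c : EReal) :=
  fun t => ((hQ t).const c).le

theorem IsSupermartingale.add (hQ : IsImpreciseTree Q) (hM : IsSupermartingale Q M)
    (hM' : IsSupermartingale Q M') (hb : BddBelowVar M) (hb' : BddBelowVar M') :
    IsSupermartingale Q fun t => M t + M' t :=
  fun t => ((hQ t).add_le _ _ (hb.comp _) (hb'.comp _)).trans (add_le_add (hM t) (hM' t))

theorem IsSupermartingale.const_mul (hQ : IsImpreciseTree Q) (hM : IsSupermartingale Q M)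
    (hb : BddBelowVar M) {r : ℝ} (hr : 0 < r) : IsSupermartingale Q fun t => (r : EReal) * M t :=
  fun t => ((hQ t).pos_homog r _ hr (hb.comp _)).trans_le
    (mul_le_mul_of_nonneg_left (hM t) (EReal.coe_nonneg.2 hr.le))

theorem IsSupermartingale.tsum (hQ : IsImpreciseTree Q) {N : ℕ → Situation X → ℝ≥0∞}
    (hN : ∀ i, IsSupermartingale Q fun t => (N i t : EReal)) :
    IsSupermartingale Q fun t => ((∑' i, N i t : ℝ≥0∞) : EReal) := by
  have hpartial (n : ℕ) :
      IsSupermartingale Q fun t => ((∑ i ∈ Finset.range n, N i t : ℝ≥0∞) : EReal) := by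
    induction n with
    | zero => simpa using isSupermartingale_const hQ 0
    | succ n ih =>
      simpa only [Finset.sum_range_succ, EReal.coe_ennreal_add] using
        ih.add hQ (hN n) (bddBelowVar_coe_ennreal _) (bddBelowVar_coe_ennreal _)
  intro t
  have hlim := (hQ t).upward_cont
    (fun n x => ((∑ i ∈ Finset.range n, N i (t ++ [x]) : ℝ≥0∞) : EReal))
    (fun x => ((∑' i, N i (t ++ [x]) : ℝ≥0∞) : EReal))
    (fun n x => EReal.coe_ennreal_nonneg _)
    (fun n x => EReal.coe_ennreal_le_coe_ennreal_iff.2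
      (Finset.sum_le_sum_of_subset (Finset.range_mono n.le_succ)))
    (fun x => EReal.tendsto_coe_ennreal.2 (ENNReal.tendsto_nat_tsum _))
  exact le_of_tendsto' hlim fun n => (hpartial n t).trans
    (EReal.coe_ennreal_le_coe_ennreal_iff.2 (ENNReal.sum_le_tsum _))

end Supermartingale

/-! ### Upcrossing strategies -/

section Upcrossing

theorem eventually_or_eventually_not_of_succ {p : ℕ → Prop}
    (h : ∀ᶠ n in atTop, p n → p (n + 1)) : (∀ᶠ n in atTop, p n) ∨ ∀ᶠ n in atTop, ¬p n := by
  obtain ⟨k, hk⟩ := eventually_atTop.1 h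
  refine or_iff_not_imp_right.2 fun hfreq => ?_
  obtain ⟨m, hkm, hm⟩ := frequently_atTop.1 hfreq k
  exact eventually_atTop.2 ⟨m, fun n hmn =>
    Nat.le_induction hm (fun j hmj => hk j (hkm.trans hmj)) n hmn⟩

/-- The strategy that buys one unit of an asset when its price `u` is at or below `α`, and sells it
when the price is at or above `β`, holds the unit after trading at time `n`. -/
def UpcrossHolds (α β : ℝ≥0∞) (u : ℕ → ℝ≥0∞) : ℕ → Prop
  | 0 => u 0 ≤ α
  | n + 1 => u (n + 1) ≤ α ∨ UpcrossHolds α β u n ∧ u (n + 1) < β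

open Classical in
/-- The number of sales that the upcrossing strategy has made by time `n`. -/
noncomputable def upcrossSales (α β : ℝ≥0∞) (u : ℕ → ℝ≥0∞) (n : ℕ) : ℕ :=
  Nat.count (fun k => UpcrossHolds α β u k ∧ ¬UpcrossHolds α β u (k + 1)) n

open Classical in
/-- The current value of the stake `α` that the upcrossing strategy reserves for its next
purchase: the price of the unit while it is held, and `α` otherwise. -/
noncomputable def upcrossStake (α β : ℝ≥0∞) (u : ℕ → ℝ≥0∞) (n : ℕ) : ℝ≥0∞ :=
  if UpcrossHolds α β u n then u n else α

/-- The capital of the upcrossing strategy: each sale has earned `β - α` on top of the stake. Any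
surplus from buying strictly below `α` or selling strictly above `β` is thrown away. -/
noncomputable def upcrossCapital (α β : ℝ≥0∞) (u : ℕ → ℝ≥0∞) (n : ℕ) : ℝ≥0∞ :=
  upcrossSales α β u n * (β - α) + upcrossStake α β u n

variable {α β : ℝ≥0∞} {u v : ℕ → ℝ≥0∞} {n : ℕ}

theorem UpcrossHolds.lt (hαβ : α < β) (h : UpcrossHolds α β u n) : u n < β := by
  cases n with
  | zero => exact lt_of_le_of_lt h hαβ
  | succ n => exact h.elim (·.trans_lt hαβ) And.right

theorem lt_of_not_upcrossHolds (h : ¬UpcrossHolds α β u n) : α < u n := by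
  cases n with
  | zero => exact not_le.1 h
  | succ n => exact not_le.1 fun hle => h (Or.inl hle)

theorem upcrossHolds_congr (h : ∀ k ≤ n, u k = v k) :
    UpcrossHolds α β u n ↔ UpcrossHolds α β v n := by
  induction n with
  | zero => simp only [UpcrossHolds, h 0 le_rfl]
  | succ n ih =>
    simp only [UpcrossHolds, h (n + 1) le_rfl, ih fun k hk => h k (hk.trans n.le_succ)]

theorem upcrossSales_congr (h : ∀ k ≤ n, u k = v k) :
    upcrossSales α β u n = upcrossSales α β v n := by
  have hholds {k : ℕ} (hk : k ≤ n) : UpcrossHolds α β u k ↔ UpcrossHolds α β v k :=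
    upcrossHolds_congr fun j hj => h j (hj.trans hk)
  classical
  simp only [upcrossSales, Nat.count_eq_card_filter_range]
  congr 1
  refine Finset.filter_congr fun k hk => ?_
  have hk' : k < n := Finset.mem_range.1 hk
  rw [hholds hk'.le, hholds hk']

theorem upcrossCapital_congr (h : ∀ k ≤ n, u k = v k) :
    upcrossCapital α β u n = upcrossCapital α β v n := by
  simp only [upcrossCapital, upcrossStake, upcrossSales_congr h, h n le_rfl]
  congr 2
  exact propext (upcrossHolds_congr h)

theorem monotone_upcrossSales : Monotone (upcrossSales α β u) :=
  by classical exact Nat.count_monotone _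

theorem upcrossSales_le : upcrossSales α β u n ≤ n :=
  by classical exact Nat.count_le _

theorem upcrossStake_le (hαβ : α < β) : upcrossStake α β u n ≤ β := by
  unfold upcrossStake
  split_ifs with h
  · exact (h.lt hαβ).le
  · exact hαβ.le

theorem upcrossCapital_le (hαβ : α < β) : upcrossCapital α β u n ≤ (n + 1) * β := by
  rw [add_one_mul]
  exact add_le_add (mul_le_mul' (Nat.cast_le.2 upcrossSales_le) tsub_le_self)
    (upcrossStake_le hαβ)

open Classical in
theorem upcrossCapital_succ_le (hαβ : α ≤ β) :
    upcrossCapital α β u (n + 1) ≤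
      upcrossSales α β u n * (β - α) + if UpcrossHolds α β u n then u (n + 1) else α := by
  have hcount := Nat.count_succ
    (fun k => UpcrossHolds α β u k ∧ ¬UpcrossHolds α β u (k + 1)) n
  simp only [upcrossCapital, upcrossStake, upcrossSales, hcount]
  by_cases hn : UpcrossHolds α β u n <;> by_cases hn' : UpcrossHolds α β u (n + 1)
  · simp [hn, hn']
  · have hsold : β ≤ u (n + 1) := not_lt.1 fun hlt => hn' (Or.inr ⟨hn, hlt⟩)
    simpa [hn, hn', add_mul, add_assoc, tsub_add_cancel_of_le hαβ] using by gcongr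
  · have hbought : u (n + 1) ≤ α := hn'.resolve_right fun h => hn h.1
    simpa [hn, hn'] using by gcongr
  · simp [hn, hn']

theorem exists_tendsto_upcrossStake (hαβ : α < β) {l : ℝ≥0∞} (hu : Tendsto u atTop (𝓝 l)) :
    ∃ c, Tendsto (upcrossStake α β u) atTop (𝓝 c) := by
  have hconst : (∀ᶠ n in atTop, UpcrossHolds α β u n) ∨ ∀ᶠ n in atTop, ¬UpcrossHolds α β u n := by
    have hu' := hu.comp (tendsto_add_atTop_nat 1)
    rcases lt_or_ge l β with hl | hl
    · refine eventually_or_eventually_not_of_succ ?_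
      filter_upwards [hu'.eventually_lt_const hl] with n hn hholds
      exact Or.inr ⟨hholds, hn⟩
    · refine ((eventually_or_eventually_not_of_succ ?_).imp_right ?_).symm
      · filter_upwards [hu'.eventually_const_lt (hαβ.trans_le hl)] with n hn hnot hholds
        exact hholds.elim hn.not_ge fun h => hnot h.1
      · exact fun h => h.mono fun _ => not_not.1
  rcases hconst with hholds | hnot
  · exact ⟨l, hu.congr' (hholds.mono fun n hn => (if_pos hn).symm)⟩
  · exact ⟨α, tendsto_const_nhds.congr' (hnot.mono fun n hn => (if_neg hn).symm)⟩

theorem tendsto_upcrossSales_atTop (hαβ : α < β) (hlow : ∃ᶠ n in atTop, u n ≤ α)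
    (hhigh : ∃ᶠ n in atTop, β ≤ u n) : Tendsto (upcrossSales α β u) atTop atTop := by
  have hsales : ∃ᶠ n in atTop, UpcrossHolds α β u n ∧ ¬UpcrossHolds α β u (n + 1) := by
    intro hfin
    have hkeep : ∀ᶠ n in atTop, UpcrossHolds α β u n → UpcrossHolds α β u (n + 1) :=
      hfin.mono fun n hn h => not_not.1 fun h' => hn ⟨h, h'⟩
    rcases eventually_or_eventually_not_of_succ hkeep with hholds | hnot
    · exact hhigh (hholds.mono fun n hn => (hn.lt hαβ).not_ge)
    · exact hlow (hnot.mono fun n hn => (lt_of_not_upcrossHolds hn).not_ge)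
  classical
  exact tendsto_atTop_atTop_of_monotone monotone_upcrossSales fun b =>
    ⟨_, (Nat.count_nth_of_infinite (Nat.frequently_atTop_iff_infinite.1 hsales) b).ge⟩

end Upcrossing

/-! ### Weighted sums of upcrossing strategies -/

section UpcrossingSum

theorem tendsto_tsum_of_dominated {ι : Type*} [Countable ι] {F : ℕ → ι → ℝ≥0∞}
    {f bound : ι → ℝ≥0∞} (hbound : ∑' i, bound i ≠ ∞) (hF : ∀ n i, F n i ≤ bound i)
    (hlim : ∀ i, Tendsto (fun n => F n i) atTop (𝓝 (f i))) :
    Tendsto (fun n => ∑' i, F n i) atTop (𝓝 (∑' i, f i)) := by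
  let _ : MeasurableSpace ι := ⊤
  simp only [← MeasureTheory.lintegral_count] at hbound ⊢
  exact MeasureTheory.tendsto_lintegral_of_dominated_convergence bound
    (fun n => measurable_of_countable _) (fun n => Eventually.of_forall (hF n)) hbound
    (Eventually.of_forall hlim)

theorem exists_seq_levels_crossed_of_not_tendsto :
    ∃ α β : ℕ → ℝ≥0∞, (∀ i, α i < β i) ∧ (∀ i, β i ≠ ∞) ∧
      ∀ u : ℕ → ℝ≥0∞, (¬∃ l, Tendsto u atTop (𝓝 l)) →
        ∃ i, (∃ᶠ n in atTop, u n ≤ α i) ∧ ∃ᶠ n in atTop, β i ≤ u n := by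
  obtain ⟨D, hcountable, hdense, -, htop⟩ := ENNReal.exists_countable_dense_no_zero_top
  let P : Set (ℝ≥0∞ × ℝ≥0∞) := {p | p.1 ∈ D ∧ p.2 ∈ D ∧ p.1 < p.2}
  have hP_countable : P.Countable :=
    (hcountable.prod hcountable).mono fun p hp => Set.mk_mem_prod hp.1 hp.2.1
  have hP_nonempty : P.Nonempty := by
    obtain ⟨b, hb, hb0, -⟩ := hdense.exists_between (zero_lt_one (α := ℝ≥0∞))
    obtain ⟨a, ha, -, hab⟩ := hdense.exists_between hb0
    exact ⟨(a, b), ha, hb, hab⟩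
  obtain ⟨p, hp⟩ := hP_countable.exists_eq_range hP_nonempty
  have hmem (i : ℕ) : p i ∈ P := hp ▸ Set.mem_range_self i
  refine ⟨fun i => (p i).1, fun i => (p i).2, fun i => (hmem i).2.2,
    fun i h => htop (h ▸ (hmem i).2.1), fun u hu => ?_⟩
  by_contra! hcross
  refine hu (tendsto_of_no_upcrossings hdense fun a ha b hb hab ⟨hlow, hhigh⟩ => ?_)
  have hab_mem : (a, b) ∈ P := ⟨ha, hb, hab⟩
  obtain ⟨i, hi⟩ : ∃ i, p i = (a, b) := hp.subset hab_mem
  have hnot_high : ∀ᶠ n in atTop, u n < b := by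
    simpa only [hi] using hcross i (hlow.mono fun n hn => by simpa only [hi] using hn.le)
  exact hhigh (hnot_high.mono fun n => not_lt_of_gt)

variable {w : ℕ → ℝ≥0} {α β : ℕ → ℝ≥0∞} {u : ℕ → ℝ≥0∞}

theorem exists_tendsto_tsum_upcrossCapital (hαβ : ∀ i, α i < β i)
    (hsum : ∑' i, w i * β i ≠ ∞) {l : ℝ≥0∞} (hu : Tendsto u atTop (𝓝 l)) :
    ∃ c, Tendsto (fun n => ∑' i, w i * upcrossCapital (α i) (β i) u n) atTop (𝓝 c) := by
  choose c hc using fun i => exists_tendsto_upcrossStake (hαβ i) hu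
  have hstake : Tendsto (fun n => ∑' i, w i * upcrossStake (α i) (β i) u n) atTop
      (𝓝 (∑' i, w i * c i)) :=
    tendsto_tsum_of_dominated hsum (fun n i => mul_le_mul_right (upcrossStake_le (hαβ i)) _)
      fun i => ENNReal.Tendsto.const_mul (hc i) (Or.inr ENNReal.coe_ne_top)
  have hprofit : Monotone fun n => ∑' i, w i * (upcrossSales (α i) (β i) u n * (β i - α i)) :=
    fun m n hmn => ENNReal.tsum_le_tsum fun i => by
      gcongr
      exact monotone_upcrossSales hmn
  refine ⟨_, ((tendsto_atTop_iSup hprofit).add hstake).congr fun n => ?_⟩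
  simp only [upcrossCapital, mul_add, ENNReal.tsum_add]

theorem tendsto_tsum_upcrossCapital_top {i : ℕ} (hw : 0 < w i) (hαβ : α i < β i)
    (hlow : ∃ᶠ n in atTop, u n ≤ α i) (hhigh : ∃ᶠ n in atTop, β i ≤ u n) :
    Tendsto (fun n => ∑' j, w j * upcrossCapital (α j) (β j) u n) atTop (𝓝 ∞) := by
  have hne : (w i : ℝ≥0∞) * (β i - α i) ≠ 0 :=
    mul_ne_zero (ENNReal.coe_ne_zero.2 hw.ne') (tsub_pos_of_lt hαβ).ne'
  have hprofit : Tendsto (fun n => (upcrossSales (α i) (β i) u n : ℝ≥0∞) *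
      (w i * (β i - α i))) atTop (𝓝 ∞) := by
    rw [← ENNReal.top_mul hne]
    exact ENNReal.Tendsto.mul_const
      (ENNReal.tendsto_nat_nhds_top.comp (tendsto_upcrossSales_atTop hαβ hlow hhigh))
      (Or.inl ENNReal.top_ne_zero)
  refine tendsto_nhds_top_mono' hprofit fun n => ?_
  calc (upcrossSales (α i) (β i) u n : ℝ≥0∞) * (w i * (β i - α i))
      = w i * (upcrossSales (α i) (β i) u n * (β i - α i)) := mul_left_comm _ _ _
    _ ≤ w i * upcrossCapital (α i) (β i) u n := mul_le_mul_right le_self_add _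
    _ ≤ ∑' j, w j * upcrossCapital (α j) (β j) u n :=
      ENNReal.le_tsum (f := fun j => w j * upcrossCapital (α j) (β j) u n) i

end UpcrossingSum

/-! ### Supermartingales that converge on every path -/

section Convergence

variable {X : Type*} {Q : Situation X → (X → EReal) → EReal}

@[simp]
theorem length_initial (ω : Path X) (n : ℕ) : (Path.initial ω n).length = n := by
  simp [Path.initial]

theorem take_initial (ω : Path X) {k n : ℕ} (h : k ≤ n) :
    (Path.initial ω n).take k = Path.initial ω k := by
  refine List.ext_getElem (by simp [h]) fun i h₁ h₂ => ?_
  simp [Path.initial]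

/-- The capital of the upcrossing strategy that trades in the process `N`, whose price history in
the situation `t` is read off along the prefixes of `t`. -/
noncomputable def upcrossProcess (α β : ℝ≥0∞) (N : Situation X → ℝ≥0∞) (t : Situation X) :
    ℝ≥0∞ :=
  upcrossCapital α β (fun k => N (t.take k)) t.length

theorem upcrossProcess_initial (α β : ℝ≥0∞) (N : Situation X → ℝ≥0∞) (ω : Path X) (n : ℕ) :
    upcrossProcess α β N (Path.initial ω n) =
      upcrossCapital α β (fun k => N (Path.initial ω k)) n := by
  rw [upcrossProcess, length_initial]
  exact upcrossCapital_congr fun k hk => by rw [take_initial ω hk]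

open Classical in
theorem upcrossProcess_append_le {α β : ℝ≥0∞} (hαβ : α ≤ β) (N : Situation X → ℝ≥0∞)
    (t : Situation X) (x : X) :
    upcrossProcess α β N (t ++ [x]) ≤
      upcrossSales α β (fun k => N (t.take k)) t.length * (β - α) +
        if UpcrossHolds α β (fun k => N (t.take k)) t.length then N (t ++ [x]) else α := by
  have hhistory : ∀ k ≤ t.length, N ((t ++ [x]).take k) = N (t.take k) :=
    fun k hk => by rw [List.take_append_of_le_length hk]
  have hnow : (t ++ [x]).take (t.length + 1) = t ++ [x] := List.take_of_length_le (by simp)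
  have hstep := upcrossCapital_succ_le (u := fun k => N ((t ++ [x]).take k)) (n := t.length) hαβ
  rw [upcrossSales_congr hhistory, hnow] at hstep
  simp only [upcrossHolds_congr hhistory] at hstep
  simpa only [upcrossProcess, List.length_append, List.length_singleton] using hstep

theorem IsSupermartingale.upcrossProcess (hQ : IsImpreciseTree Q) {N : Situation X → ℝ≥0∞}
    (hN : IsSupermartingale Q fun t => (N t : EReal)) {α β : ℝ≥0∞} (hαβ : α ≤ β) :
    IsSupermartingale Q fun t => (upcrossProcess α β N t : EReal) := by
  classical
  intro t
  set u : ℕ → ℝ≥0∞ := fun k => N (t.take k) with hu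
  set profit : ℝ≥0∞ := upcrossSales α β u t.length * (β - α)
  have hstake : Q t (fun x => ((if UpcrossHolds α β u t.length then N (t ++ [x]) else α : ℝ≥0∞) :
      EReal)) ≤ (upcrossStake α β u t.length : EReal) := by
    unfold upcrossStake
    split_ifs
    · simpa only [hu, List.take_length] using hN t
    · exact (hQ t).const_le α
  calc Q t (fun x => (GameTheoretic.upcrossProcess α β N (t ++ [x]) : EReal))
      ≤ Q t (fun x => (profit : EReal) +
          ((if UpcrossHolds α β u t.length then N (t ++ [x]) else α : ℝ≥0∞) : EReal)) := by
        refine (hQ t).mono _ _ (bddBelowVar_coe_ennreal _)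
          ((bddBelowVar_coe_ennreal _).add (bddBelowVar_coe_ennreal _)) fun x => ?_
        rw [← EReal.coe_ennreal_add]
        exact EReal.coe_ennreal_le_coe_ennreal_iff.2 (upcrossProcess_append_le hαβ N t x)
    _ ≤ Q t (fun _ => (profit : EReal)) + Q t (fun x =>
          ((if UpcrossHolds α β u t.length then N (t ++ [x]) else α : ℝ≥0∞) : EReal)) :=
        (hQ t).add_le _ _ (bddBelowVar_coe_ennreal _) (bddBelowVar_coe_ennreal _)
    _ ≤ profit + upcrossStake α β u t.length := add_le_add ((hQ t).const_le profit) hstake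
    _ = GameTheoretic.upcrossProcess α β N t := (EReal.coe_ennreal_add _ _).symm

theorem IsSupermartingale.add_tsum_upcrossProcess (hQ : IsImpreciseTree Q)
    {N : Situation X → ℝ≥0∞} (hN : IsSupermartingale Q fun t => (N t : EReal)) {w : ℕ → ℝ≥0}
    (hw : ∀ i, 0 < w i) {α β : ℕ → ℝ≥0∞} (hαβ : ∀ i, α i ≤ β i) :
    IsSupermartingale Q fun t =>
      ((N t + ∑' i, w i * GameTheoretic.upcrossProcess (α i) (β i) N t : ℝ≥0∞) : EReal) := by
  simp only [EReal.coe_ennreal_add]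
  refine hN.add hQ (.tsum hQ fun i => ?_) (bddBelowVar_coe_ennreal _) (bddBelowVar_coe_ennreal _)
  simpa only [EReal.coe_ennreal_mul, EReal.coe_nnreal_eq_coe_real] using
    (hN.upcrossProcess hQ (hαβ i)).const_mul hQ (bddBelowVar_coe_ennreal _)
      (NNReal.coe_pos.2 (hw i))

theorem IsSupermartingale.exists_tendsto_of_nonneg (hQ : IsImpreciseTree Q)
    {N : Situation X → ℝ≥0∞} (hN : IsSupermartingale Q fun t => (N t : EReal)) (s : Situation X)
    {ε : ℝ≥0∞} (hε : ε ≠ 0) :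
    ∃ T : Situation X → ℝ≥0∞, IsSupermartingale Q (fun t => (T t : EReal)) ∧ (∀ t, N t ≤ T t) ∧
      T s ≤ N s + ε ∧ ∀ ω, ∃ c, Tendsto (fun n => T (Path.initial ω n)) atTop (𝓝 c) := by
  obtain ⟨α, β, hαβ, hβ, hcross⟩ := exists_seq_levels_crossed_of_not_tendsto
  obtain ⟨w, hw, hsum⟩ := ENNReal.exists_pos_tsum_mul_lt_of_countable hε
    (fun i => (s.length + 1) * β i) fun i => ENNReal.mul_ne_top (by finiteness) (hβ i)
  have hfin : ∑' i, w i * β i ≠ ∞ := by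
    refine ne_top_of_le_ne_top hsum.ne_top (ENNReal.tsum_le_tsum fun i => ?_)
    rw [mul_comm (w i : ℝ≥0∞)]
    gcongr
    exact le_mul_of_one_le_left' le_add_self
  refine ⟨_, hN.add_tsum_upcrossProcess hQ hw fun i => (hαβ i).le, fun t => le_self_add,
    add_le_add le_rfl ((ENNReal.tsum_le_tsum fun i => ?_).trans hsum.le), fun ω => ?_⟩
  · rw [mul_comm (w i : ℝ≥0∞)]
    exact mul_le_mul_left (upcrossCapital_le (hαβ i)) _
  · simp only [upcrossProcess_initial]
    by_cases hconv : ∃ l, Tendsto (fun n => N (Path.initial ω n)) atTop (𝓝 l)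
    · obtain ⟨l, hl⟩ := hconv
      obtain ⟨c, hc⟩ := exists_tendsto_tsum_upcrossCapital hαβ hfin hl
      exact ⟨l + c, hl.add hc⟩
    · obtain ⟨i, hlow, hhigh⟩ := hcross _ hconv
      exact ⟨∞, tendsto_nhds_top_mono' (tendsto_tsum_upcrossCapital_top (hw i) (hαβ i) hlow hhigh)
        fun n => le_add_self⟩

theorem IsSupermartingale.exists_tendsto (hQ : IsImpreciseTree Q) {M : Situation X → EReal}
    (hM : IsSupermartingale Q M) (hb : BddBelowVar M) (s : Situation X) {ε : ℝ≥0} (hε : 0 < ε) :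
    ∃ T : Situation X → EReal, IsSupermartingale Q T ∧ BddBelowVar T ∧ (∀ t, M t ≤ T t) ∧
      T s ≤ M s + (ε : ℝ≥0∞) ∧
      ∀ ω, ∃ c, Tendsto (fun n => T (Path.initial ω n)) atTop (𝓝 c) := by
  obtain ⟨m, N, rfl⟩ := hb.exists_eq_coe_ennreal_add
  have hN : IsSupermartingale Q fun t => (N t : EReal) := by
    simpa only [EReal.coe_neg, ← sub_eq_add_neg, EReal.add_sub_cancel_right] using
      hM.add hQ (isSupermartingale_const hQ (-m)) hb (bddBelowVar_const (-m))
  obtain ⟨T, hT, hNT, hTs, hlim⟩ :=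
    hN.exists_tendsto_of_nonneg hQ s (ENNReal.coe_ne_zero.2 hε.ne')
  have hTb := bddBelowVar_coe_ennreal T
  refine ⟨fun t => (T t : EReal) + m,
    hT.add hQ (isSupermartingale_const hQ m) hTb (bddBelowVar_const m),
    hTb.add (bddBelowVar_const m),
    fun t => add_le_add (EReal.coe_ennreal_le_coe_ennreal_iff.2 (hNT t)) le_rfl, ?_, fun ω => ?_⟩
  · rw [add_right_comm, ← EReal.coe_ennreal_add]
    exact add_le_add (EReal.coe_ennreal_le_coe_ennreal_iff.2 hTs) le_rfl
  · obtain ⟨c, hc⟩ := hlim ω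
    have hadd : ContinuousAt (fun p : EReal × EReal => p.1 + p.2) (c, m) :=
      EReal.continuousAt_add (Or.inr (EReal.coe_ne_bot m)) (Or.inr (EReal.coe_ne_top m))
    exact ⟨c + m, hadd.tendsto.comp
      ((EReal.tendsto_coe_ennreal.2 hc).prodMk_nhds tendsto_const_nhds)⟩

end Convergence

/-! ### Approximation by limits of finitary variables -/

section Approximation

variable {X : Type*} {Q : Situation X → (X → EReal) → EReal} {M : Situation X → EReal}

theorem mem_cylinder_of_prefix_initial {s : Situation X} {ω : Path X} {n : ℕ}
    (h : s <+: Path.initial ω n) : ω ∈ cylinder s := by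
  have hlen : s.length ≤ n := by simpa using h.length_le
  exact (take_initial ω hlen).symm.trans (List.prefix_iff_eq_take.1 h).symm

theorem prefix_initial_of_mem_cylinder {s : Situation X} {ω : Path X} (hω : ω ∈ cylinder s)
    {n : ℕ} (hn : s.length ≤ n) : s <+: Path.initial ω n :=
  List.prefix_iff_eq_take.2 ((take_initial ω hn).trans hω).symm

open Classical in
/-- The process that agrees with `M` in `s` and all situations that follow it, and that is infinite
in all other situations. It turns bounds on `Γ(s)` into bounds on all paths. -/
noncomputable def processFrom (s : Situation X) (M : Situation X → EReal) (t : Situation X) :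
    EReal :=
  if s <+: t then M t else ⊤

theorem processFrom_self (s : Situation X) (M : Situation X → EReal) : processFrom s M s = M s :=
  if_pos List.prefix_rfl

theorem BddBelowVar.processFrom (hb : BddBelowVar M) (s : Situation X) :
    BddBelowVar (processFrom s M) := by
  obtain ⟨m, hm⟩ := hb
  refine ⟨m, fun t => ?_⟩
  unfold GameTheoretic.processFrom
  split_ifs
  · exact hm t
  · exact le_top

theorem IsSupermartingale.processFrom (hM : IsSupermartingale Q M) (s : Situation X) :
    IsSupermartingale Q (processFrom s M) := by
  intro t
  by_cases ht : s <+: t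
  · simpa only [GameTheoretic.processFrom, ht, ht.trans (List.prefix_append t _), if_true]
      using hM t
  · exact le_top.trans_eq (if_neg ht).symm

theorem le_liminfProcess_processFrom {f : Path X → EReal} {s : Situation X}
    (h : ∀ ω ∈ cylinder s, f ω ≤ liminfProcess M ω) (ω : Path X) :
    f ω ≤ liminfProcess (processFrom s M) ω := by
  by_cases hω : ω ∈ cylinder s
  · refine (h ω hω).trans_eq (liminf_congr ?_)
    filter_upwards [eventually_ge_atTop s.length] with n hn
    exact (if_pos (prefix_initial_of_mem_cylinder hω hn)).symm
  · have htop (n : ℕ) : processFrom s M (Path.initial ω n) = ⊤ :=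
      if_neg fun h => hω (mem_cylinder_of_prefix_initial h)
    simp [liminfProcess, htop]

theorem liminfProcess_mem_limFinitary (hb : BddBelowVar M)
    (hlim : ∀ ω, ∃ c, Tendsto (fun n => M (Path.initial ω n)) atTop (𝓝 c)) :
    liminfProcess M ∈ limFinitary X := by
  obtain ⟨m, hm⟩ := hb
  refine ⟨⟨m, fun ω => le_liminf_of_le (h := Eventually.of_forall fun n => hm _)⟩,
    fun n ω => M (Path.initial ω n), fun n => ⟨n, fun ω ω' h => congrArg M h⟩, fun ω => ?_⟩
  obtain ⟨c, hc⟩ := hlim ω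
  rwa [liminfProcess, hc.liminf_eq]

theorem upperE_mono {f g : Path X → EReal} {s : Situation X} (h : ∀ ω ∈ cylinder s, f ω ≤ g ω) :
    upperE Q f s ≤ upperE Q g s := by
  refine sInf_le_sInf ?_
  rintro a ⟨M, hM, hb, hg, rfl⟩
  exact ⟨M, hM, hb, fun ω hω => (h ω hω).trans (hg ω hω), rfl⟩

theorem IsSupermartingale.exists_limFinitary_upperE_le (hQ : IsImpreciseTree Q)
    (hM : IsSupermartingale Q M) (hb : BddBelowVar M) {s : Situation X} {f : Path X → EReal}
    (hf : ∀ ω ∈ cylinder s, f ω ≤ liminfProcess M ω) {ε : ℝ≥0} (hε : 0 < ε) :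
    ∃ g ∈ limFinitary X, (∀ ω, f ω ≤ g ω) ∧ upperE Q g s ≤ M s + (ε : ℝ≥0∞) := by
  obtain ⟨T, hT, hTb, hMT, hTs, hlim⟩ :=
    (hM.processFrom s).exists_tendsto hQ (hb.processFrom s) s hε
  refine ⟨liminfProcess T, liminfProcess_mem_limFinitary hTb hlim, fun ω => ?_, ?_⟩
  · exact (le_liminfProcess_processFrom hf ω).trans
      (liminf_le_liminf (Eventually.of_forall fun n => hMT _))
  · rw [processFrom_self] at hTs
    exact sInf_le_of_le ⟨T, hT, hTb, fun ω _ => le_rfl, rfl⟩ hTs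

theorem le_of_forall_pos_le_add_coe {a b : EReal}
    (h : ∀ ε : ℝ≥0, 0 < ε → a ≤ b + (ε : ℝ≥0∞)) : a ≤ b := by
  refine EReal.le_of_forall_lt_iff_le.1 fun z hz => ?_
  obtain ⟨y, hby, hyz⟩ := EReal.lt_iff_exists_real_btwn.1 hz
  have hpos : 0 < z - y := sub_pos.2 (EReal.coe_lt_coe_iff.1 hyz)
  lift z - y to ℝ≥0 using hpos.le with ε hε
  calc a ≤ b + (ε : ℝ≥0∞) := h ε (NNReal.coe_pos.1 hpos)
    _ ≤ y + (ε : ℝ≥0∞) := add_le_add hby.le le_rfl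
    _ = z := by rw [EReal.coe_nnreal_eq_coe_real, hε, ← EReal.coe_add, add_sub_cancel]

theorem sInf_upperE_limFinitary_le (hQ : IsImpreciseTree Q) (f : Path X → EReal)
    (s : Situation X) :
    sInf {a | ∃ g ∈ limFinitary X, (∀ ω, f ω ≤ g ω) ∧ a = upperE Q g s} ≤ upperE Q f s := by
  refine le_sInf ?_
  rintro _ ⟨M, hM, hb, hf, rfl⟩
  refine le_of_forall_pos_le_add_coe fun ε hε => ?_
  obtain ⟨g, hg, hfg, hle⟩ := hM.exists_limFinitary_upperE_le hQ hb hf hε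
  exact sInf_le_of_le ⟨g, hg, hfg, rfl⟩ hle

theorem upperE_eq_sInf_upperE_limFinitary (hQ : IsImpreciseTree Q) (f : Path X → EReal)
    (s : Situation X) :
    upperE Q f s = sInf {a | ∃ g ∈ limFinitary X, (∀ ω, f ω ≤ g ω) ∧ a = upperE Q g s} := by
  refine le_antisymm (le_sInf ?_) (sInf_upperE_limFinitary_le hQ f s)
  rintro _ ⟨g, -, hfg, rfl⟩
  exact upperE_mono fun ω _ => hfg ω

theorem upperE_eq_sInf_upperE_limFinitary_cylinder (hQ : IsImpreciseTree Q) (f : Path X → EReal)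
    (s : Situation X) :
    upperE Q f s = sInf {a | ∃ g ∈ limFinitary X, (∀ ω ∈ cylinder s, f ω ≤ g ω) ∧
      a = upperE Q g s} := by
  refine le_antisymm (le_sInf ?_) ((sInf_le_sInf ?_).trans (sInf_upperE_limFinitary_le hQ f s))
  · rintro _ ⟨g, -, hfg, rfl⟩
    exact upperE_mono hfg
  · rintro _ ⟨g, hg, hfg, rfl⟩
    exact ⟨g, hg, fun ω _ => hfg ω, rfl⟩

end Approximation

end GameTheoretic

theorem mainTheorem4_general {X : Type*}
    (Q : GameTheoretic.Situation X → (X → EReal) → EReal)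
    (hQ : GameTheoretic.IsImpreciseTree Q) (s : GameTheoretic.Situation X) :
    (∀ f : GameTheoretic.Path X → EReal,
      GameTheoretic.upperE Q f s =
        sInf {a | ∃ g ∈ GameTheoretic.limFinitary X,
          (∀ ω ∈ GameTheoretic.cylinder s, f ω ≤ g ω) ∧ a = GameTheoretic.upperE Q g s} ∧
      GameTheoretic.upperE Q f s =
        sInf {a | ∃ g ∈ GameTheoretic.limFinitary X,
          (∀ ω, f ω ≤ g ω) ∧ a = GameTheoretic.upperE Q g s}) ∧
    (∀ Q' : GameTheoretic.Situation X → (X → EReal) → EReal,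
      GameTheoretic.IsImpreciseTree Q' →
      (∀ g ∈ GameTheoretic.limFinitary X,
        GameTheoretic.upperE Q' g s = GameTheoretic.upperE Q g s) →
      ∀ f : GameTheoretic.Path X → EReal,
        GameTheoretic.upperE Q' f s = GameTheoretic.upperE Q f s) := by
  refine ⟨fun f => ⟨GameTheoretic.upperE_eq_sInf_upperE_limFinitary_cylinder hQ f s,
    GameTheoretic.upperE_eq_sInf_upperE_limFinitary hQ f s⟩, fun Q' hQ' hagree f => ?_⟩
  rw [GameTheoretic.upperE_eq_sInf_upperE_limFinitary hQ' f s,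
    GameTheoretic.upperE_eq_sInf_upperE_limFinitary hQ f s]
  congr 1 with a
  exact exists_congr fun g => and_congr_right fun hg => by rw [hagree g hg]

theorem mainTheorem4 {X : Type*} [Finite X] [Nonempty X]
    (Q : GameTheoretic.Situation X → (X → EReal) → EReal)
    (hQ : GameTheoretic.IsImpreciseTree Q) (s : GameTheoretic.Situation X) :
    (∀ f : GameTheoretic.Path X → EReal,
      GameTheoretic.upperE Q f s =
        sInf {a | ∃ g ∈ GameTheoretic.limFinitary X,
          (∀ ω ∈ GameTheoretic.cylinder s, f ω ≤ g ω) ∧ a = GameTheoretic.upperE Q g s} ∧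
      GameTheoretic.upperE Q f s =
        sInf {a | ∃ g ∈ GameTheoretic.limFinitary X,
          (∀ ω, f ω ≤ g ω) ∧ a = GameTheoretic.upperE Q g s}) ∧
    (∀ Q' : GameTheoretic.Situation X → (X → EReal) → EReal,
      GameTheoretic.IsImpreciseTree Q' →
      (∀ g ∈ GameTheoretic.limFinitary X,
        GameTheoretic.upperE Q' g s = GameTheoretic.upperE Q g s) →
      ∀ f : GameTheoretic.Path X → EReal,
        GameTheoretic.upperE Q' f s = GameTheoretic.upperE Q f s) :=
  mainTheorem4_general Q hQ s
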